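/- Consider the linear bandit problem in the plane in which exactly one action is chosen per round. In every round the choice set is the unit circle $S^1\subset\mathbb R^2$; playing $x_t\in S^1$ in round $t$ yields the reward $y_t=\langle\beta,x_t\rangle+\eta_t$, where the $\eta_t$ are independent and uniform on $(-1,1)$ and $\beta\in S^1$ is unknown. An algorithm with input parameter $\delta$ chooses, in round $t$, a probability distribution $\pi_t$ on $S^1$ that depends on $\delta$ and, measurably, on the past actions and rewards $x_1,y_1,\dots,x_{t-1},y_{t-1}$, and draws $x_t\sim\pi_t$. Call a probability distribution on $S^1$ monotone for $\beta$ if either it is discrete and its mass function $g$ satisfies $g(x)\ge g(x')$ whenever $x,x'\in S^1$ and $\langle\beta,x\rangle\ge\langle\beta,x'\rangle$, or it has a density $g$ with respect to arc length with the same property. Say that $\pi_t$ is round-fair for $\beta$ if it is a finite or countable mixture of probability distributions that are monotone for $\beta$. An algorithm is fair over $T$ rounds if for every $\delta\in(0,1]$ and every $\beta\in S^1$, when it is run with input $\delta$ on the instance $\beta$, with probability at least $1-\delta$ the distribution $\pi_t$ is round-fair for $\beta$ in every round $t\le T$. Theorem. Every fair algorithm has expected regret $\Omega(T)$, for every $\beta$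 and every $T$. Precisely, there is an absolute constant $c>0$ such that for every $T\ge1$, every algorithm that is fair over $T$ rounds, every $\delta\in(0,1)$ and every $\beta\in S^1$, the algorithm run with input $\delta$ on the instance $\beta$ satisfies $$\mathbb E_\beta[R(T)]=\sum_{t=1}^T\max_{x\in S^1}\langle\beta,x\rangle-\mathbb E_\beta\Big[\sum_{t=1}^T y_t\Big]\ \ge\ c\,(1-\delta)\,T .$$ -/

import Mathlib

open MeasureTheory ProbabilityTheory Set
open scoped ENNReal

namespace FairBandit

noncomputable section

/-- The Euclidean space `ℝᵈ` of actions and of linear coefficients. -/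
abbrev Vec (d : ℕ) : Type := EuclideanSpace ℝ (Fin d)

/-- A history of `n` rounds: the chosen action and the observed reward of each of them. -/
abbrev History (d n : ℕ) : Type := Fin n → Vec d × ℝ

/-- A randomized algorithm for the linear bandit problem in which exactly one action is chosen in
each round, facing the choice sets `C 0, C 1, …` (rounds are numbered from `0`): in round `t` it
draws its action from a distribution on `C t` that depends measurably on the history of the
previous `t` rounds. -/
structure BanditAlgorithm {d : ℕ} (C : ℕ → Set (Vec d)) where
  /-- The distribution of the action of round `t`, given the previous actions and rewards. -/
  policy : (t : ℕ) → Kernel (History d t) (Vec d)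
  markov : ∀ t, IsMarkovKernel (policy t)
  feasible : ∀ t h, policy t h (C t)ᶜ = 0

/-- The law of the reward `y = ⟨β, x⟩ + η` of an action `x`, where the noise `η` has law `ν`. -/
def rewardKernel {d : ℕ} (ν : Measure ℝ) (β : Vec d) : Kernel (Vec d) ℝ :=
  (Kernel.id ×ₖ Kernel.const (Vec d) ν).map (fun p : Vec d × ℝ => inner ℝ β p.1 + p.2)

/-- The joint law of action and reward in round `t`, given the history of the previous rounds. -/
def BanditAlgorithm.stepKernel {d : ℕ} {C : ℕ → Set (Vec d)} (A : BanditAlgorithm C)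
    (ν : Measure ℝ) (β : Vec d) (t : ℕ) : Kernel (History d t) (Vec d × ℝ) :=
  A.policy t ⊗ₖ Kernel.prodMkLeft (History d t) (rewardKernel ν β)

/-- The law of the history of the first `n` rounds when the algorithm interacts with the instance
with coefficients `β` and independent noise variables of law `ν`. -/
def BanditAlgorithm.law {d : ℕ} {C : ℕ → Set (Vec d)} (A : BanditAlgorithm C)
    (ν : Measure ℝ) (β : Vec d) : (n : ℕ) → Measure (History d n)
  | 0 => Measure.dirac (fun i => i.elim0)
  | n + 1 => (A.law ν β n ⊗ₘ A.stepKernel ν β n).map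
      (fun p => Fin.snoc (α := fun _ => Vec d × ℝ) p.1 p.2)

/-- The pseudo-regret `Rew(P*) - Rew(A)` after `T` rounds (for mean-zero noise `ν`): the expected
total reward of the best actions minus the expected total reward of the algorithm, the expectation
being over the noise and the random choices of the algorithm. -/
def BanditAlgorithm.regret {d : ℕ} {C : ℕ → Set (Vec d)} (A : BanditAlgorithm C)
    (ν : Measure ℝ) (β : Vec d) (T : ℕ) : ℝ :=
  (∑ t ∈ Finset.range T, sSup ((fun x => inner ℝ β x) '' C t)) -
    ∫ h, (∑ t, (h t).2) ∂(A.law ν β T)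

/-- `π` is discrete, and its mass function is monotone in the expected reward on `C`. -/
def DiscreteFair {d : ℕ} (C : Set (Vec d)) (β : Vec d) (π : Measure (Vec d)) : Prop :=
  (∃ S : Set (Vec d), S.Countable ∧ π Sᶜ = 0) ∧
    ∀ x ∈ C, ∀ x' ∈ C, (inner ℝ β x' : ℝ) ≤ inner ℝ β x → π {x'} ≤ π {x}

/-- `π` is continuous (it has a density with respect to the reference measure `σ`), and it has a
density that is monotone in the expected reward on `C`. -/
def ContinuousFair {d : ℕ} (C : Set (Vec d)) (σ : Measure (Vec d)) (β : Vec d)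
    (π : Measure (Vec d)) : Prop :=
  ∃ f : Vec d → ℝ≥0∞, Measurable f ∧ π = σ.withDensity f ∧
    ∀ x ∈ C, ∀ x' ∈ C, (inner ℝ β x' : ℝ) ≤ inner ℝ β x → f x' ≤ f x

/-- Round-fairness of the distribution `π` on the choice set `C`: `π` is a finite or countable
mixture of probability distributions each of which is discrete or continuous and satisfies the
corresponding monotonicity condition. A single such distribution is the mixture all of whose
components are equal; a finite mixture is one in which all but finitely many weights vanish. -/
def RoundFair {d : ℕ} (C : Set (Vec d)) (σ : Measure (Vec d)) (β : Vec d)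
    (π : Measure (Vec d)) : Prop :=
  ∃ (a : ℕ → ℝ≥0∞) (ρ : ℕ → Measure (Vec d)), ∑' i, a i = 1 ∧
    (∀ i, IsProbabilityMeasure (ρ i) ∧ (DiscreteFair C β (ρ i) ∨ ContinuousFair C σ β (ρ i))) ∧
    π = Measure.sum (fun i => a i • ρ i)

/-- (Weakly meritocratic) fairness over `T` rounds of an algorithm `A` with input parameter `δ`,
on the instances with coefficients in `B` and noise `ν`: for every `δ ∈ (0, 1]` and every `β ∈ B`,
with probability at least `1 - δ` the distribution of `A δ` is round-fair in every round. -/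
def IsFair {d : ℕ} {C : ℕ → Set (Vec d)} (A : ℝ → BanditAlgorithm C) (σ : Measure (Vec d))
    (ν : Measure ℝ) (B : Set (Vec d)) (T : ℕ) : Prop :=
  ∀ δ ∈ Ioc (0 : ℝ) 1, ∀ β ∈ B, ∃ G : Set (History d T), MeasurableSet G ∧
    ENNReal.ofReal (1 - δ) ≤ (A δ).law ν β T G ∧
    ∀ h ∈ G, ∀ t : Fin T,
      RoundFair (C t) σ β ((A δ).policy t (Fin.take (t : ℕ) t.isLt.le h))

/-- The unit circle `S¹` in the plane. -/
def unitCircle : Set (Vec 2) := Metric.sphere 0 1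

/-- The arc-length measure on the unit circle. -/
def arcLength : Measure (Vec 2) :=
  (volume.restrict (Ioc (-Real.pi) Real.pi)).map (fun θ : ℝ => !₂[Real.cos θ, Real.sin θ])

/-- The uniform distribution on `(-1, 1)`. -/
def uniformNoise : Measure ℝ := volume[|Ioo (-1 : ℝ) 1]

instance : IsProbabilityMeasure uniformNoise :=
  cond_isProbabilityMeasure_of_finite (by simp) (by simp)

end

end FairBandit

/-! A distribution that is round-fair for `β` has its mean on the line spanned by `β`: reflection in
this line preserves expected rewards, so a monotone mass function or density is invariant under it.
A distribution that is round-fair for two independent vectors therefore has mean zero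
(`integral_inner_eq_zero_of_roundFair`).

Uniform noise makes nearby instances hard to tell apart: over `T` rounds the history laws of `β` and
`β'` differ by at most `T * ‖β - β'‖` (`lintegral_law_le`). Take instances `b n → β`, pairwise
independent. The event of fairness for `b n` has probability at least `1 - δ - o(1)` under `β`, so
with probability at least `1 - δ` infinitely many of these events occur (`le_measure_frequently`).
The action distributions depend only on `δ` and the history, so there they are fair for two
independent vectors, have mean zero, and lose 1 in every round. -/

namespace FairBandit

noncomputable section

/-! ### Reflection in the line of `β` -/

/-- The cross product of two vectors of the plane. -/
def cross (b x : Vec 2) : ℝ := b 0 * x 1 - b 1 * x 0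

/-- The reflection of the plane that fixes the unit vector `b`. -/
def mirror (b x : Vec 2) : Vec 2 := (2 * inner ℝ b x : ℝ) • b - x

lemma inner_eq (b x : Vec 2) : (inner ℝ b x : ℝ) = b 0 * x 0 + b 1 * x 1 := by
  simp [PiLp.inner_apply, Fin.sum_univ_two, mul_comm]

lemma mem_unitCircle_iff (x : Vec 2) : x ∈ unitCircle ↔ x 0 ^ 2 + x 1 ^ 2 = 1 := by
  rw [unitCircle, mem_sphere_zero_iff_norm, ← sq_eq_sq₀ (norm_nonneg _) zero_le_one,
    EuclideanSpace.norm_sq_eq]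
  simp [Fin.sum_univ_two]

lemma norm_eq_one_of_mem_unitCircle {x : Vec 2} (hx : x ∈ unitCircle) : ‖x‖ = 1 := by
  simpa [unitCircle] using hx

lemma mirror_apply (b x : Vec 2) (i : Fin 2) :
    mirror b x i = 2 * (b 0 * x 0 + b 1 * x 1) * b i - x i := by
  simp [mirror, inner_eq]

lemma mirror_mirror {b : Vec 2} (hb : b ∈ unitCircle) (x : Vec 2) :
    mirror b (mirror b x) = x := by
  rw [mem_unitCircle_iff] at hb
  ext i
  simp only [mirror_apply]
  linear_combination 4 * (b 0 * x 0 + b 1 * x 1) * b i * hb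

lemma inner_mirror {b : Vec 2} (hb : b ∈ unitCircle) (x : Vec 2) :
    (inner ℝ b (mirror b x) : ℝ) = inner ℝ b x := by
  rw [mem_unitCircle_iff] at hb
  simp only [inner_eq, mirror_apply]
  linear_combination 2 * (b 0 * x 0 + b 1 * x 1) * hb

lemma cross_mirror (b x : Vec 2) : cross b (mirror b x) = -cross b x := by
  simp only [cross, mirror_apply]
  ring

lemma mirror_mem_unitCircle {b x : Vec 2} (hb : b ∈ unitCircle) (hx : x ∈ unitCircle) :
    mirror b x ∈ unitCircle := by
  rw [mem_unitCircle_iff] at hb hx ⊢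
  simp only [mirror_apply]
  linear_combination 4 * (b 0 * x 0 + b 1 * x 1) ^ 2 * hb + hx

@[fun_prop]
lemma measurable_cross (b : Vec 2) : Measurable (cross b) := by
  unfold cross
  fun_prop

/-! ### Means of round-fair distributions -/

lemma abs_coord_le_one {x : Vec 2} (hx : x ∈ unitCircle) (i : Fin 2) : |x i| ≤ 1 := by
  rw [← norm_eq_one_of_mem_unitCircle hx, ← Real.norm_eq_abs]
  exact PiLp.norm_apply_le x i

lemma integrable_coord {ρ : Measure (Vec 2)} [IsFiniteMeasure ρ]
    (hC : ρ unitCircleᶜ = 0) (i : Fin 2) : Integrable (fun x : Vec 2 => x i) ρ := by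
  refine Integrable.of_bound (C := 1) (by fun_prop) ?_
  filter_upwards [measure_eq_zero_iff_ae_notMem.1 hC] with x hx
  exact abs_coord_le_one (not_not.1 hx) i

/-- Mirror images have equal expected reward, so monotonicity in both directions gives them equal
mass, while `cross β` changes sign. -/
lemma integral_cross_eq_zero_of_discreteFair {β : Vec 2} (hβ : β ∈ unitCircle)
    {ρ : Measure (Vec 2)} (hC : ρ unitCircleᶜ = 0) (h : DiscreteFair unitCircle β ρ) :
    ∫ x, cross β x ∂ρ = 0 := by
  by_cases hint : Integrable (cross β) ρ
  swap; · exact integral_undef hint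
  obtain ⟨⟨S, hS, hSρ⟩, hmono⟩ := h
  -- Monotonicity is known only on the circle; adding the mirror images makes the reflection a
  -- permutation of the support.
  let S' : Set (Vec 2) := (S ∩ unitCircle) ∪ mirror β '' (S ∩ unitCircle)
  have hS'count : S'.Countable :=
    (hS.mono inter_subset_left).union ((hS.mono inter_subset_left).image _)
  have hS'circ : ∀ x ∈ S', x ∈ unitCircle := by
    rintro x (hx | ⟨y, hy, rfl⟩)
    · exact hx.2
    · exact mirror_mem_unitCircle hβ hy.2
  have hS'mir : ∀ x ∈ S', mirror β x ∈ S' := by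
    rintro x (hx | ⟨y, hy, rfl⟩)
    · exact Or.inr ⟨x, hx, rfl⟩
    · rw [mirror_mirror hβ]
      exact Or.inl hy
  have hS'ae : ∀ᵐ x ∂ρ, x ∈ S' := by
    filter_upwards [measure_eq_zero_iff_ae_notMem.1 hC, measure_eq_zero_iff_ae_notMem.1 hSρ]
      with x hx hx'
    exact Or.inl ⟨not_not.1 hx', not_not.1 hx⟩
  rw [← Measure.restrict_eq_self_of_ae_mem hS'ae,
    setIntegral_countable _ hS'count hint.integrableOn]
  let e : S' ≃ S' :=
    { toFun := fun x => ⟨mirror β x, hS'mir x x.2⟩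
      invFun := fun x => ⟨mirror β x, hS'mir x x.2⟩
      left_inv := fun x => Subtype.ext (mirror_mirror hβ x)
      right_inv := fun x => Subtype.ext (mirror_mirror hβ x) }
  have hsymm : ∀ x : S', ρ.real {((e x : S') : Vec 2)} • cross β (e x)
      = -(ρ.real {(x : Vec 2)} • cross β x) := by
    intro x
    have hx := hS'circ x x.2
    have hx' := mirror_mem_unitCircle hβ hx
    have heq : ρ {mirror β x} = ρ {(x : Vec 2)} :=
      le_antisymm (hmono _ hx _ hx' (inner_mirror hβ x).le)
        (hmono _ hx' _ hx (inner_mirror hβ x).ge)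
    change ρ.real {mirror β x} • cross β (mirror β x) = _
    rw [cross_mirror, Measure.real, heq, smul_neg, Measure.real]
  have hsum := e.tsum_eq (fun x : S' => ρ.real {(x : Vec 2)} • cross β x)
  simp only [hsymm, tsum_neg] at hsum
  linarith

lemma exists_angle {x : Vec 2} (hx : x ∈ unitCircle) :
    ∃ φ : ℝ, x = !₂[Real.cos φ, Real.sin φ] := by
  rw [mem_unitCircle_iff] at hx
  have hz : ‖(⟨x 0, x 1⟩ : ℂ)‖ = 1 := by
    rw [← sq_eq_sq₀ (norm_nonneg _) zero_le_one, Complex.sq_norm, Complex.normSq_mk]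
    linarith
  refine ⟨Complex.arg ⟨x 0, x 1⟩, ?_⟩
  have h0 : (⟨x 0, x 1⟩ : ℂ) ≠ 0 := by
    intro h
    simp [h] at hz
  ext i
  fin_cases i
  · simp [Complex.cos_arg h0, hz]
  · simp [Complex.sin_arg, hz]

lemma circle_mem (θ : ℝ) : (!₂[Real.cos θ, Real.sin θ] : Vec 2) ∈ unitCircle := by
  simp [mem_unitCircle_iff]

lemma measurable_circle : Measurable (fun θ : ℝ => (!₂[Real.cos θ, Real.sin θ] : Vec 2)) := by
  have : Continuous (fun θ : ℝ => (!₂[Real.cos θ, Real.sin θ] : Vec 2)) := by fun_prop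
  exact this.measurable

lemma cross_circle (φ θ : ℝ) :
    cross !₂[Real.cos φ, Real.sin φ] !₂[Real.cos θ, Real.sin θ] = Real.sin (θ - φ) := by
  simp [cross, Real.sin_sub]
  ring

lemma inner_circle (φ θ : ℝ) :
    (inner ℝ (!₂[Real.cos φ, Real.sin φ] : Vec 2) !₂[Real.cos θ, Real.sin θ] : ℝ)
      = Real.cos (θ - φ) := by
  simp [inner_eq, Real.cos_sub]
  ring

/-- In the angle, the density is even about `φ` and the cross product `sin (θ - φ)` is odd. -/
lemma integral_cross_eq_zero_of_continuousFair {β : Vec 2} (hβ : β ∈ unitCircle)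
    {ρ : Measure (Vec 2)} [IsFiniteMeasure ρ]
    (h : ContinuousFair unitCircle arcLength β ρ) : ∫ x, cross β x ∂ρ = 0 := by
  obtain ⟨f, hf, rfl, hmono⟩ := h
  obtain ⟨φ, rfl⟩ := exists_angle hβ
  have hfin : ∀ᵐ x ∂arcLength, f x < ∞ := by
    refine ae_lt_top hf ?_
    rw [← setLIntegral_univ, ← withDensity_apply _ MeasurableSet.univ]
    exact measure_ne_top _ _
  let γ : ℝ → Vec 2 := fun θ => !₂[Real.cos θ, Real.sin θ]
  let g : ℝ → ℝ := fun θ => (f (γ θ)).toReal * Real.sin (θ - φ)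
  have hint : ∫ x, cross !₂[Real.cos φ, Real.sin φ] x ∂(arcLength.withDensity f)
      = ∫ θ in (-Real.pi)..Real.pi, g θ := by
    rw [integral_withDensity_eq_integral_toReal_smul hf hfin, arcLength,
      integral_map (f := fun x => (f x).toReal • cross !₂[Real.cos φ, Real.sin φ] x)
        measurable_circle.aemeasurable
        (hf.ennreal_toReal.smul (measurable_cross _)).aestronglyMeasurable,
      intervalIntegral.integral_of_le (by linarith [Real.pi_pos])]
    simp only [cross_circle, smul_eq_mul, g, γ]
  have hper : Function.Periodic g (2 * Real.pi) := by
    intro θ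
    have : θ + 2 * Real.pi - φ = θ - φ + 2 * Real.pi := by ring
    simp only [g, γ, this, Real.cos_add_two_pi, Real.sin_add_two_pi]
  have hodd : ∀ θ, g (2 * φ - θ) = -g θ := by
    intro θ
    have hin : (inner ℝ (!₂[Real.cos φ, Real.sin φ] : Vec 2) (γ (2 * φ - θ)) : ℝ)
        = inner ℝ (!₂[Real.cos φ, Real.sin φ] : Vec 2) (γ θ) := by
      rw [inner_circle, inner_circle, ← Real.cos_neg]
      congr 1
      ring
    have hfeq : f (γ (2 * φ - θ)) = f (γ θ) :=
      le_antisymm (hmono _ (circle_mem _) _ (circle_mem _) hin.le)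
        (hmono _ (circle_mem _) _ (circle_mem _) hin.ge)
    simp only [g, hfeq]
    rw [← mul_neg, ← Real.sin_neg]
    congr 2
    ring
  -- The substitution `θ ↦ 2 * φ - θ` moves the window of integration; periodicity moves it back.
  have h1 : ∫ θ in (-Real.pi)..Real.pi, g θ
      = ∫ θ in (2 * φ - Real.pi)..(2 * φ - -Real.pi), g θ := by
    have := hper.intervalIntegral_add_eq (-Real.pi) (2 * φ - Real.pi)
    rw [show -Real.pi + 2 * Real.pi = Real.pi by ring,
      show 2 * φ - Real.pi + 2 * Real.pi = 2 * φ - -Real.pi by ring] at this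
    exact this
  have h2 := intervalIntegral.integral_comp_sub_left (a := -Real.pi) (b := Real.pi) g (2 * φ)
  simp only [hodd, intervalIntegral.integral_neg] at h2
  rw [hint]
  linarith

lemma integral_cross_eq_zero_of_roundFair {β : Vec 2} (hβ : β ∈ unitCircle)
    {π : Measure (Vec 2)} [IsProbabilityMeasure π] (hC : π unitCircleᶜ = 0)
    (h : RoundFair unitCircle arcLength β π) : ∫ x, cross β x ∂π = 0 := by
  have hint : Integrable (cross β) π :=
    ((integrable_coord hC 1).const_mul _).sub ((integrable_coord hC 0).const_mul _)
  obtain ⟨a, ρ, -, hρ, rfl⟩ := h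
  rw [integral_sum_measure hint]
  refine (tsum_congr fun i => ?_).trans tsum_zero
  have := (hρ i).1
  rw [integral_smul_measure]
  -- A component of weight zero need not live on the circle.
  by_cases ha : a i = 0
  · simp [ha]
  have hCi : ρ i unitCircleᶜ = 0 := by
    rw [Measure.sum_apply_eq_zero] at hC
    simpa [ha] using hC i
  rcases (hρ i).2 with hd | hc
  · rw [integral_cross_eq_zero_of_discreteFair hβ hCi hd, smul_zero]
  · rw [integral_cross_eq_zero_of_continuousFair hβ hc, smul_zero]

/-- A distribution on the circle that is round-fair for two independent coefficient vectors has
mean zero. -/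
lemma integral_inner_eq_zero_of_roundFair {β₁ β₂ : Vec 2} (h₁ : β₁ ∈ unitCircle)
    (h₂ : β₂ ∈ unitCircle) (hne : cross β₁ β₂ ≠ 0) {π : Measure (Vec 2)}
    [IsProbabilityMeasure π] (hC : π unitCircleᶜ = 0)
    (hf₁ : RoundFair unitCircle arcLength β₁ π) (hf₂ : RoundFair unitCircle arcLength β₂ π)
    (β : Vec 2) : ∫ x, (inner ℝ β x : ℝ) ∂π = 0 := by
  have hi := integrable_coord hC
  have hcross : ∀ b : Vec 2, ∫ x, cross b x ∂π = b 0 * ∫ x, x 1 ∂π - b 1 * ∫ x, x 0 ∂π := by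
    intro b
    simp only [cross]
    rw [integral_sub ((hi 1).const_mul _) ((hi 0).const_mul _), integral_const_mul,
      integral_const_mul]
  have e₁ := integral_cross_eq_zero_of_roundFair h₁ hC hf₁
  have e₂ := integral_cross_eq_zero_of_roundFair h₂ hC hf₂
  rw [hcross] at e₁ e₂
  simp only [inner_eq]
  rw [integral_add ((hi 0).const_mul _) ((hi 1).const_mul _), integral_const_mul,
      integral_const_mul]
  set m₀ := ∫ x, x 0 ∂π
  set m₁ := ∫ x, x 1 ∂π
  -- Cramer's rule for the two linear equations `e₁`, `e₂` in the mean.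
  have k₀ : m₀ = 0 := by
    refine (mul_eq_zero.1 (?_ : cross β₁ β₂ * m₀ = 0)).resolve_left hne
    simp only [cross]
    linear_combination β₂ 0 * e₁ - β₁ 0 * e₂
  have k₁ : m₁ = 0 := by
    refine (mul_eq_zero.1 (?_ : cross β₁ β₂ * m₁ = 0)).resolve_left hne
    simp only [cross]
    linear_combination β₂ 1 * e₁ - β₁ 1 * e₂
  rw [k₀, k₁]
  ring

attribute [instance] BanditAlgorithm.markov

/-! ### Laws of histories -/

section Law

variable {d : ℕ} {C : ℕ → Set (Vec d)} (A : BanditAlgorithm C) (ν : Measure ℝ)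
  [IsProbabilityMeasure ν] (β : Vec d)

lemma rewardKernel_apply (x : Vec d) :
    rewardKernel ν β x = ν.map (fun η => inner ℝ β x + η) := by
  rw [rewardKernel, Kernel.map_apply _ (by fun_prop), Kernel.prod_apply, Kernel.id_apply,
    Kernel.const_apply, Measure.dirac_prod, Measure.map_map (by fun_prop) (by fun_prop)]
  rfl

instance : IsMarkovKernel (rewardKernel ν β) :=
  Kernel.IsMarkovKernel.map _ (by fun_prop)

instance (t : ℕ) : IsMarkovKernel (A.stepKernel ν β t) := by
  unfold BanditAlgorithm.stepKernel
  infer_instance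

lemma measurable_snoc (n : ℕ) :
    Measurable (fun p : History d n × (Vec d × ℝ) =>
      (Fin.snoc (α := fun _ => Vec d × ℝ) p.1 p.2 : History d (n + 1))) := by
  refine measurable_pi_iff.2 fun i => ?_
  refine Fin.lastCases ?_ (fun j => ?_) i
  · simpa using measurable_snd
  · simp only [Fin.snoc_castSucc]
    fun_prop

instance isProbabilityMeasure_law (n : ℕ) : IsProbabilityMeasure (A.law ν β n) := by
  induction n with
  | zero => rw [BanditAlgorithm.law]; infer_instance
  | succ n ih =>
    rw [BanditAlgorithm.law]
    exact Measure.isProbabilityMeasure_map (measurable_snoc n).aemeasurable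

lemma lintegral_stepKernel (t : ℕ) (h : History d t) {F : Vec d × ℝ → ℝ≥0∞}
    (hF : Measurable F) :
    ∫⁻ p, F p ∂A.stepKernel ν β t h
      = ∫⁻ x, ∫⁻ η, F (x, inner ℝ β x + η) ∂ν ∂A.policy t h := by
  rw [BanditAlgorithm.stepKernel, Kernel.lintegral_compProd _ _ _ hF]
  refine lintegral_congr fun x => ?_
  rw [Kernel.prodMkLeft_apply, rewardKernel_apply, lintegral_map (by fun_prop) (by fun_prop)]

lemma lintegral_law_succ (n : ℕ) {F : History d (n + 1) → ℝ≥0∞} (hF : Measurable F) :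
    ∫⁻ h, F h ∂A.law ν β (n + 1)
      = ∫⁻ h, ∫⁻ p, F (Fin.snoc (α := fun _ => Vec d × ℝ) h p) ∂A.stepKernel ν β n h
          ∂A.law ν β n := by
  rw [BanditAlgorithm.law, lintegral_map hF (measurable_snoc n),
    Measure.lintegral_compProd (f := fun p => F (Fin.snoc (α := fun _ => Vec d × ℝ) p.1 p.2))
      (hF.comp (measurable_snoc n))]

/-- Consistency of the laws lets each round be treated as the last round of a shorter run. -/
lemma map_take_law {m n : ℕ} (hmn : m ≤ n) :
    (A.law ν β n).map (Fin.take m hmn) = A.law ν β m := by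
  induction n, hmn using Nat.le_induction with
  | base =>
    have : (Fin.take m le_rfl : History d m → History d m) = id := by
      ext1 h
      exact Fin.take_eq_self h
    rw [this, Measure.map_id]
  | succ n hmn ih =>
    have hmeas : Measurable (Fin.take m hmn : History d n → History d m) :=
      measurable_pi_iff.2 fun i => measurable_pi_apply _
    have hcomp : (Fin.take m (hmn.trans n.le_succ) : History d (n + 1) → History d m) ∘
        (fun p : History d n × (Vec d × ℝ) => Fin.snoc (α := fun _ => Vec d × ℝ) p.1 p.2)
        = Fin.take m hmn ∘ Prod.fst := by
      funext p i
      exact Fin.snoc_castSucc (α := fun _ => Vec d × ℝ) p.2 p.1 (Fin.castLE hmn i)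
    have hmeas' : Measurable
        (Fin.take m (hmn.trans n.le_succ) : History d (n + 1) → History d m) :=
      measurable_pi_iff.2 fun i => measurable_pi_apply _
    rw [BanditAlgorithm.law, Measure.map_map hmeas' (measurable_snoc n), hcomp,
      ← Measure.map_map hmeas measurable_fst]
    change (Measure.fst _).map _ = _
    rw [Measure.fst_compProd, ih]

end Law

/-! ### Uniform noise and indistinguishable instances -/

lemma uniformNoise_eq : uniformNoise = (2 : ℝ≥0∞)⁻¹ • volume.restrict (Ioo (-1 : ℝ) 1) := by
  rw [uniformNoise, ProbabilityTheory.cond, Real.volume_Ioo]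
  norm_num

lemma lintegral_uniformNoise_shift (g : ℝ → ℝ≥0∞) (a : ℝ) :
    ∫⁻ η, g (a + η) ∂uniformNoise = 2⁻¹ * ∫⁻ y in Ioo (a - 1) (a + 1), g y := by
  rw [uniformNoise_eq, lintegral_smul_measure, smul_eq_mul, ← lintegral_indicator measurableSet_Ioo,
    ← lintegral_indicator measurableSet_Ioo,
    ← lintegral_add_left_eq_self ((Ioo (a - 1) (a + 1)).indicator g) a]
  congr 2
  ext η
  have : a + η ∈ Ioo (a - 1) (a + 1) ↔ η ∈ Ioo (-1 : ℝ) 1 := by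
    constructor <;> rintro ⟨h1, h2⟩ <;> constructor <;> linarith
  simp only [indicator, this]

/-- Two shifts of the uniform noise are close in total variation. -/
lemma lintegral_uniformNoise_shift_le {g : ℝ → ℝ≥0∞} (hg : ∀ y, g y ≤ 1)
    (a b : ℝ) :
    ∫⁻ η, g (a + η) ∂uniformNoise
      ≤ ∫⁻ η, g (b + η) ∂uniformNoise + ENNReal.ofReal |a - b| := by
  rw [lintegral_uniformNoise_shift, lintegral_uniformNoise_shift]
  -- Each of the two leftover intervals has length at most `|a - b|`; the noise density 1/2 absorbs
  -- the factor 2.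
  have hsub : Ioo (a - 1) (a + 1)
      ⊆ Ioo (b - 1) (b + 1) ∪ (Ioc (a - 1) (b - 1) ∪ Ico (b + 1) (a + 1)) := by
    rintro y ⟨h1, h2⟩
    by_cases h3 : b - 1 < y
    · by_cases h4 : y < b + 1
      · exact Or.inl ⟨h3, h4⟩
      · exact Or.inr (Or.inr ⟨not_lt.1 h4, h2⟩)
    · exact Or.inr (Or.inl ⟨h1, not_lt.1 h3⟩)
  have hone : ∀ s : Set ℝ, ∫⁻ y in s, g y ≤ volume s := fun s =>
    (lintegral_mono fun y => hg y).trans_eq (by simp)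
  have hvol : ∫⁻ y in Ioc (a - 1) (b - 1) ∪ Ico (b + 1) (a + 1), g y
      ≤ 2 * ENNReal.ofReal |a - b| := by
    refine (hone _).trans ((measure_union_le _ _).trans ?_)
    rw [Real.volume_Ioc, Real.volume_Ico, two_mul]
    refine add_le_add (ENNReal.ofReal_le_ofReal ?_) (ENNReal.ofReal_le_ofReal ?_)
    · linarith [neg_abs_le (a - b)]
    · linarith [le_abs_self (a - b)]
  calc (2 : ℝ≥0∞)⁻¹ * ∫⁻ y in Ioo (a - 1) (a + 1), g y
      ≤ 2⁻¹ * ((∫⁻ y in Ioo (b - 1) (b + 1), g y) + 2 * ENNReal.ofReal |a - b|) := by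
        gcongr
        exact (lintegral_mono_set hsub).trans
          ((lintegral_union_le _ _ _).trans (add_le_add_right hvol _))
    _ = 2⁻¹ * (∫⁻ y in Ioo (b - 1) (b + 1), g y) + ENNReal.ofReal |a - b| := by
        rw [mul_add, ← mul_assoc, ENNReal.inv_mul_cancel (by simp) (by simp), one_mul]

/-- With uniform noise, the laws of the history on two instances are close in total variation. -/
lemma lintegral_law_le (A : BanditAlgorithm (fun _ : ℕ => unitCircle)) (β β' : Vec 2) (n : ℕ)
    {F : History 2 n → ℝ≥0∞} (hF : Measurable F) (hF1 : ∀ h, F h ≤ 1) :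
    ∫⁻ h, F h ∂A.law uniformNoise β n
      ≤ ∫⁻ h, F h ∂A.law uniformNoise β' n + n * ENNReal.ofReal ‖β - β'‖ := by
  induction n with
  | zero => simp [BanditAlgorithm.law]
  | succ n ih =>
    have hsnoc : ∀ h : History 2 n, Measurable
        (fun p : Vec 2 × ℝ => F (Fin.snoc (α := fun _ => Vec 2 × ℝ) h p)) := fun h =>
      hF.comp ((measurable_snoc n).comp measurable_prodMk_left)
    -- Given the history, both instances draw the action from the same law; on the circle the reward
    -- means differ by at most `‖β - β'‖`.
    have hstep : ∀ h : History 2 n,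
        ∫⁻ p, F (Fin.snoc (α := fun _ => Vec 2 × ℝ) h p) ∂A.stepKernel uniformNoise β n h
        ≤ ∫⁻ p, F (Fin.snoc (α := fun _ => Vec 2 × ℝ) h p) ∂A.stepKernel uniformNoise β' n h
          + ENNReal.ofReal ‖β - β'‖ := by
      intro h
      rw [lintegral_stepKernel _ _ _ _ _ (hsnoc h), lintegral_stepKernel _ _ _ _ _ (hsnoc h)]
      calc _ ≤ ∫⁻ x, (∫⁻ η, F (Fin.snoc (α := fun _ => Vec 2 × ℝ) h (x, inner ℝ β' x + η))
              ∂uniformNoise + ENNReal.ofReal ‖β - β'‖) ∂A.policy n h := by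
            refine lintegral_mono_ae ?_
            filter_upwards [measure_eq_zero_iff_ae_notMem.1 (A.feasible n h)] with x hx
            have hx1 := norm_eq_one_of_mem_unitCircle (not_not.1 hx)
            refine (lintegral_uniformNoise_shift_le
              (g := fun y => F (Fin.snoc (α := fun _ => Vec 2 × ℝ) h (x, y)))
              (fun _ => hF1 _) _ (inner ℝ β' x)).trans ?_
            gcongr
            rw [← inner_sub_left]
            simpa [hx1] using abs_real_inner_le_norm (β - β') x
        _ = _ := by
            rw [lintegral_add_right _ measurable_const]
            simp
    -- With the last step already moved to `β'`, what remains is a function of the shorter history,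
    -- to which the induction hypothesis applies.
    have hmeas : Measurable fun h : History 2 n =>
        ∫⁻ p, F (Fin.snoc (α := fun _ => Vec 2 × ℝ) h p) ∂A.stepKernel uniformNoise β' n h :=
      (hF.comp (measurable_snoc n)).lintegral_kernel_prod_right'
    have hle : ∀ h : History 2 n,
        ∫⁻ p, F (Fin.snoc (α := fun _ => Vec 2 × ℝ) h p) ∂A.stepKernel uniformNoise β' n h ≤ 1 :=
      fun h => (lintegral_mono fun p => hF1 _).trans_eq (by simp)
    rw [lintegral_law_succ _ _ _ _ hF, lintegral_law_succ _ _ _ _ hF]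
    refine (lintegral_mono hstep).trans ?_
    rw [lintegral_add_right _ measurable_const, lintegral_const, measure_univ, mul_one]
    refine (add_le_add_left (ih hmeas hle) _).trans_eq ?_
    push_cast
    ring

/-! ### Expected rewards and regret -/

lemma abs_inner_le_one {β x : Vec 2} (hβ : β ∈ unitCircle) (hx : x ∈ unitCircle) :
    |(inner ℝ β x : ℝ)| ≤ 1 := by
  simpa [norm_eq_one_of_mem_unitCircle hβ, norm_eq_one_of_mem_unitCircle hx]
    using abs_real_inner_le_norm β x

lemma ae_abs_uniformNoise_le : ∀ᵐ η ∂uniformNoise, |η| ≤ 1 := by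
  filter_upwards [ae_cond_mem (μ := volume) (measurableSet_Ioo (a := (-1 : ℝ)) (b := 1))]
    with η hη
  exact abs_le.2 ⟨hη.1.le, hη.2.le⟩

lemma integrable_id_uniformNoise : Integrable (fun η : ℝ => η) uniformNoise :=
  Integrable.of_bound (by fun_prop) 1 ae_abs_uniformNoise_le

lemma integral_id_uniformNoise : ∫ η, η ∂uniformNoise = 0 := by
  rw [uniformNoise_eq, integral_smul_measure, ← integral_Ioc_eq_integral_Ioo,
    ← intervalIntegral.integral_of_le (by norm_num)]
  simp

section Reward

variable (A : BanditAlgorithm (fun _ : ℕ => unitCircle)) {β : Vec 2}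

lemma ae_mem_unitCircle (n : ℕ) (h : History 2 n) : ∀ᵐ x ∂A.policy n h, x ∈ unitCircle := by
  filter_upwards [measure_eq_zero_iff_ae_notMem.1 (A.feasible n h)] with x hx
  exact not_not.1 hx

lemma measurable_reward {T : ℕ} (t : Fin T) :
    Measurable (fun h : History 2 T => (h t).2) :=
  (measurable_pi_apply t).snd

lemma lintegral_enorm_reward_stepKernel_le (hβ : β ∈ unitCircle) (n : ℕ) (h : History 2 n) :
    ∫⁻ p, ‖p.2‖ₑ ∂A.stepKernel uniformNoise β n h ≤ 2 := by
  rw [lintegral_stepKernel _ _ _ _ _ (by fun_prop)]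
  have hx : ∀ᵐ x ∂A.policy n h, ∫⁻ η, ‖(inner ℝ β x + η : ℝ)‖ₑ ∂uniformNoise ≤ 2 := by
    filter_upwards [ae_mem_unitCircle A n h] with x hx
    have : ∀ᵐ η ∂uniformNoise, ‖(inner ℝ β x + η : ℝ)‖ₑ ≤ 2 := by
      filter_upwards [ae_abs_uniformNoise_le] with η hη
      rw [Real.enorm_eq_ofReal_abs, ENNReal.ofReal_le_iff_le_toReal (by simp)]
      refine (abs_add_le _ _).trans ?_
      have := abs_inner_le_one hβ hx
      simp only [ENNReal.toReal_ofNat]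
      linarith
    exact (lintegral_mono_ae this).trans_eq (by simp)
  exact (lintegral_mono_ae hx).trans_eq (by simp)

lemma integral_reward_stepKernel (hβ : β ∈ unitCircle) (n : ℕ) (h : History 2 n) :
    ∫ p, p.2 ∂A.stepKernel uniformNoise β n h = ∫ x, (inner ℝ β x : ℝ) ∂A.policy n h := by
  have hint : Integrable (fun p : Vec 2 × ℝ => p.2) (A.stepKernel uniformNoise β n h) :=
    ⟨by fun_prop, (lintegral_enorm_reward_stepKernel_le A hβ n h).trans_lt (by simp)⟩
  rw [BanditAlgorithm.stepKernel] at hint ⊢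
  rw [integral_compProd hint]
  refine integral_congr_ae (Filter.Eventually.of_forall fun x => ?_)
  dsimp only
  rw [Kernel.prodMkLeft_apply, rewardKernel_apply,
    integral_map (by fun_prop) (by fun_prop),
    integral_add (integrable_const _) integrable_id_uniformNoise, integral_id_uniformNoise]
  simp

lemma integrable_last_reward (hβ : β ∈ unitCircle) (n : ℕ) :
    Integrable (fun h : History 2 (n + 1) => (h (Fin.last n)).2)
      (A.law uniformNoise β (n + 1)) := by
  refine ⟨(measurable_reward _).aestronglyMeasurable, ?_⟩
  rw [HasFiniteIntegral, lintegral_law_succ _ _ _ _ (measurable_reward _).enorm]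
  simp only [Fin.snoc_last]
  exact ((lintegral_mono fun h => lintegral_enorm_reward_stepKernel_le A hβ n h).trans_eq
    (by simp)).trans_lt (b := 2) (by simp)

lemma integral_last_reward (hβ : β ∈ unitCircle) (n : ℕ) :
    ∫ h, (h (Fin.last n)).2 ∂A.law uniformNoise β (n + 1)
      = ∫ h, ∫ x, (inner ℝ β x : ℝ) ∂A.policy n h ∂A.law uniformNoise β n := by
  have hint := integrable_last_reward A hβ n
  rw [BanditAlgorithm.law] at hint ⊢
  rw [integrable_map_measure hint.aestronglyMeasurable (measurable_snoc n).aemeasurable] at hint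
  rw [integral_map (measurable_snoc n).aemeasurable
    (measurable_reward _).aestronglyMeasurable]
  simp only [Function.comp_def, Fin.snoc_last] at hint ⊢
  rw [Measure.integral_compProd hint]
  simp only [integral_reward_stepKernel A hβ]

lemma measurable_take {m n : ℕ} (hmn : m ≤ n) :
    Measurable (Fin.take m hmn : History 2 n → History 2 m) :=
  measurable_pi_iff.2 fun _ => measurable_pi_apply _

lemma integrable_reward (hβ : β ∈ unitCircle) {T : ℕ} (t : Fin T) :
    Integrable (fun h : History 2 T => (h t).2) (A.law uniformNoise β T) := by
  have hint := integrable_last_reward A hβ t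
  rw [← map_take_law A uniformNoise β (Nat.succ_le_of_lt t.isLt)] at hint
  exact hint.comp_measurable (measurable_take _)

lemma integral_reward (hβ : β ∈ unitCircle) {T : ℕ} (t : Fin T) :
    ∫ h, (h t).2 ∂A.law uniformNoise β T
      = ∫ h, ∫ x, (inner ℝ β x : ℝ) ∂A.policy t h ∂A.law uniformNoise β t := by
  rw [← integral_last_reward A hβ, ← map_take_law A uniformNoise β (Nat.succ_le_of_lt t.isLt),
    integral_map (measurable_take _).aemeasurable (measurable_reward _).aestronglyMeasurable]
  rfl

lemma regret_eq (hβ : β ∈ unitCircle) (T : ℕ) :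
    A.regret uniformNoise β T = ∑ t : Fin T,
      (1 - ∫ h, ∫ x, (inner ℝ β x : ℝ) ∂A.policy t h ∂A.law uniformNoise β t) := by
  have hsup : sSup ((fun x : Vec 2 => (inner ℝ β x : ℝ)) '' unitCircle) = 1 := by
    refine IsGreatest.csSup_eq ⟨⟨β, hβ, ?_⟩, ?_⟩
    · simp [norm_eq_one_of_mem_unitCircle hβ]
    · rintro _ ⟨x, hx, rfl⟩
      exact (abs_le.1 (abs_inner_le_one hβ hx)).2
  rw [BanditAlgorithm.regret, integral_finsetSum _ fun t _ => integrable_reward A hβ t,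
    Finset.sum_sub_distrib]
  simp only [hsup, integral_reward A hβ]
  simp

/-- The expected reward of a round is at most the probability that the action distribution of the
round does not have mean reward zero. -/
lemma integral_integral_inner_le (hβ : β ∈ unitCircle) (n : ℕ) :
    ∫ h, ∫ x, (inner ℝ β x : ℝ) ∂A.policy n h ∂A.law uniformNoise β n
      ≤ 1 - (A.law uniformNoise β n).real {h | ∫ x, (inner ℝ β x : ℝ) ∂A.policy n h = 0} := by
  set r : History 2 n → ℝ := fun h => ∫ x, (inner ℝ β x : ℝ) ∂A.policy n h with hr
  have hrm : Measurable r := by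
    have : StronglyMeasurable (fun x : Vec 2 => (inner ℝ β x : ℝ)) :=
      (by fun_prop : Measurable _).stronglyMeasurable
    exact this.integral_kernel.measurable
  have hr1 : ∀ h, |r h| ≤ 1 := by
    intro h
    have := norm_integral_le_of_norm_le_const (μ := A.policy n h) (C := 1)
      (f := fun x : Vec 2 => (inner ℝ β x : ℝ)) (by
        filter_upwards [ae_mem_unitCircle A n h] with x hx
        exact abs_inner_le_one hβ hx)
    simpa using this
  have hF : MeasurableSet {h | r h = 0} := hrm (measurableSet_singleton 0)
  rw [← probReal_compl_eq_one_sub hF, ← integral_indicator_one hF.compl]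
  refine integral_mono (Integrable.of_bound hrm.aestronglyMeasurable 1 (Filter.Eventually.of_forall
    hr1)) ((integrable_indicator_iff hF.compl).2 (integrable_const 1).integrableOn) fun h => ?_
  by_cases h0 : r h = 0
  · change r h ≤ _
    rw [h0]
    exact indicator_nonneg (fun _ _ => zero_le_one) h
  · rw [indicator_of_mem (by exact h0)]
    exact (abs_le.1 (hr1 h)).2

end Reward

/-! ### Passing to the limit along nearby instances -/

lemma le_measure_frequently {α : Type*} [MeasurableSpace α] {μ : Measure α} [IsFiniteMeasure μ]
    {G : ℕ → Set α} (hG : ∀ n, MeasurableSet (G n)) {c : ℝ≥0∞} {ε : ℕ → ℝ≥0∞}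
    (hε : Filter.Tendsto ε Filter.atTop (nhds 0)) (hc : ∀ n, c ≤ μ (G n) + ε n) :
    c ≤ μ {x | ∃ᶠ n in Filter.atTop, x ∈ G n} := by
  have heq : {x | ∃ᶠ n in Filter.atTop, x ∈ G n} = ⋂ n, ⋃ m ≥ n, G m := by
    ext x
    simp [Filter.frequently_atTop]
  rw [heq]
  have hanti : Antitone fun n => ⋃ m ≥ n, G m := fun a b hab =>
    biUnion_subset_biUnion_left fun m (hm : b ≤ m) => hab.trans hm
  -- Continuity from above for the tail unions, each of which contains `G n`.
  have hlim := tendsto_measure_iInter_atTop (μ := μ)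
    (fun n => (MeasurableSet.biUnion (to_countable _) fun m _ => hG m).nullMeasurableSet)
    hanti ⟨0, measure_ne_top _ _⟩
  have := hlim.add hε
  rw [add_zero] at this
  refine ge_of_tendsto' this fun n => (hc n).trans ?_
  exact add_le_add_left (measure_mono (subset_biUnion_of_mem (u := G) (le_refl n))) _

/-- On every instance, a fair algorithm plays with probability at least `1 - δ` only action
distributions with mean reward zero. -/
lemma ofReal_one_sub_le_law_forall_integral_inner_eq_zero {T : ℕ}
    {A : ℝ → BanditAlgorithm (fun _ : ℕ => unitCircle)}
    (hA : IsFair A arcLength uniformNoise unitCircle T) {δ : ℝ} (hδ : 0 < δ) (hδ' : δ < 1)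
    {β : Vec 2} (hβ : β ∈ unitCircle) :
    ENNReal.ofReal (1 - δ) ≤ (A δ).law uniformNoise β T
      {h | ∀ t : Fin T,
        ∫ x, (inner ℝ β x : ℝ) ∂(A δ).policy t (Fin.take (t : ℕ) t.isLt.le h) = 0} := by
  obtain ⟨φ, hφ⟩ := exists_angle hβ
  -- The angles are distinct and lie within 1 < π of each other, so no two of the vectors are
  -- parallel.
  let θ : ℕ → ℝ := fun n => φ + 1 / ((n : ℝ) + 1)
  let b : ℕ → Vec 2 := fun n => !₂[Real.cos (θ n), Real.sin (θ n)]
  have hb : ∀ n, b n ∈ unitCircle := fun n => circle_mem _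
  have hblim : Filter.Tendsto b Filter.atTop (nhds β) := by
    have hcont : Continuous (fun θ : ℝ => (!₂[Real.cos θ, Real.sin θ] : Vec 2)) := by fun_prop
    have hθ : Filter.Tendsto θ Filter.atTop (nhds φ) := by
      simpa [θ] using (tendsto_one_div_add_atTop_nhds_zero_nat (𝕜 := ℝ)).const_add φ
    rw [hφ]
    exact (hcont.tendsto φ).comp hθ
  choose G hGm hG hfair using fun n => hA δ ⟨hδ, hδ'.le⟩ (b n) (hb n)
  have hlow : ∀ n, ENNReal.ofReal (1 - δ) ≤ (A δ).law uniformNoise β T (G n)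
      + T * ENNReal.ofReal ‖b n - β‖ := by
    intro n
    have := lintegral_law_le (A δ) (b n) β T (F := (G n).indicator 1)
      (measurable_one.indicator (hGm n)) (fun h => indicator_le_self' (by simp) h)
    rw [lintegral_indicator_one (hGm n), lintegral_indicator_one (hGm n)] at this
    exact (hG n).trans this
  have hε : Filter.Tendsto (fun n => (T : ℝ≥0∞) * ENNReal.ofReal ‖b n - β‖) Filter.atTop
      (nhds 0) := by
    have h1 : Filter.Tendsto (fun n => ENNReal.ofReal ‖b n - β‖) Filter.atTop (nhds 0) := by
      rw [← ENNReal.ofReal_zero]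
      exact ENNReal.tendsto_ofReal (tendsto_iff_norm_sub_tendsto_zero.1 hblim)
    simpa using ENNReal.Tendsto.const_mul h1 (Or.inr (ENNReal.natCast_ne_top T))
  refine (le_measure_frequently hGm hε hlow).trans (measure_mono fun h hh t => ?_)
  -- Of the infinitely many instances for which `h` is fair, two suffice.
  obtain ⟨n, hn⟩ := hh.exists
  obtain ⟨m, hnm, hm⟩ := Filter.frequently_atTop.1 hh (n + 1)
  refine integral_inner_eq_zero_of_roundFair (hb n) (hb m) ?_ ((A δ).feasible _ _)
    (hfair n h hn t) (hfair m h hm t) β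
  rw [cross_circle]
  have hlt : 1 / ((m : ℝ) + 1) < 1 / ((n : ℝ) + 1) := by
    have : (n : ℝ) < m := by exact_mod_cast hnm
    gcongr
  have hpos : 0 < 1 / ((m : ℝ) + 1) := by positivity
  have hle : 1 / ((n : ℝ) + 1) ≤ 1 := by
    rw [div_le_one (by positivity)]
    linarith [n.cast_nonneg (α := ℝ)]
  refine (Real.sin_neg_of_neg_of_neg_pi_lt ?_ ?_).ne
  · simp only [θ]; linarith
  · simp only [θ]; linarith [Real.pi_gt_three]

end

end FairBandit

theorem mainTheorem4 :
    ∃ c : ℝ, 0 < c ∧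
      ∀ T : ℕ, 1 ≤ T →
      ∀ A : ℝ → FairBandit.BanditAlgorithm (fun _ : ℕ => FairBandit.unitCircle),
        FairBandit.IsFair A FairBandit.arcLength FairBandit.uniformNoise
          FairBandit.unitCircle T →
        ∀ δ : ℝ, 0 < δ → δ < 1 → ∀ β ∈ FairBandit.unitCircle,
          c * (1 - δ) * (T : ℝ) ≤
            (A δ).regret FairBandit.uniformNoise β T := by
  refine ⟨1, one_pos, fun T _ A hA δ hδ hδ' β hβ => ?_⟩
  have hE :=
    FairBandit.ofReal_one_sub_le_law_forall_integral_inner_eq_zero hA hδ hδ' hβ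
  rw [FairBandit.regret_eq _ hβ]
  have hround : ∀ t : Fin T, 1 - δ ≤ 1 - ∫ h, ∫ x, (inner ℝ β x : ℝ) ∂(A δ).policy t h
      ∂(A δ).law FairBandit.uniformNoise β t := by
    intro t
    -- The loss of round `t` is at least the probability of a zero mean, which contains the event
    -- `hE` after passing to the marginal of the first `t` rounds.
    refine le_trans ?_ (sub_le_sub_left (FairBandit.integral_integral_inner_le (A δ) hβ t) 1)
    rw [sub_sub_cancel, MeasureTheory.Measure.real,
      ← ENNReal.ofReal_le_iff_le_toReal (MeasureTheory.measure_ne_top _ _),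
      ← FairBandit.map_take_law (A δ) FairBandit.uniformNoise β t.isLt.le]
    refine le_trans ?_ (MeasureTheory.Measure.le_map_apply
      (FairBandit.measurable_take _).aemeasurable _)
    exact hE.trans (MeasureTheory.measure_mono fun h hh => hh t)
  calc 1 * (1 - δ) * (T : ℝ) = ∑ _t : Fin T, (1 - δ) := by
        rw [Finset.sum_const, Finset.card_univ, Fintype.card_fin, nsmul_eq_mul]
        ring
    _ ≤ _ := Finset.sum_le_sum fun t _ => hround t
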